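/- Let $G=(V,E)$ be a finite simple undirected graph with $V=\{1,\dots,p\}$, $p\ge 2$, let $q=p-1$, and suppose that $e=(q,p)$ is an edge of $G$. Let $G^{-e}$ be the graph obtained from $G$ by removing $e$, and let $\delta>2$ be real. **Graph assumptions.** A path is minimal if it has no chord. Let $\Lambda$ be the set of minimal paths of $G^{-e}$ between $q$ and $p$. For $\lambda\in\Lambda$ with vertices $q,1_\lambda,2_\lambda,\dots,\ell_\lambda,p$, let $E_\lambda$ be its set of edges, $V_\lambda=\{1_\lambda,\dots,\ell_\lambda\}$ its set of interior vertices and $V_\lambda^{(-1)}=V_\lambda\setminus\{1_\lambda\}$. Assume: (a) $G^{-e}$ consists of $q$, $p$ and the vertices and edges of the paths $\lambda\in\Lambda$; (b) the paths in $\Lambda$ are pairwise disjoint, that is, two distinct ones have no edge in common; (c) for some enumeration $\lambda_1,\dots,\lambda_L$ of $\Lambda$ in which the paths with $\ell_\lambda=1$ come last, the increasing order of the vertices is $$1_{\lambda_1},\dots,\ell_{\lambda_1},\,1_{\lambda_2},\dots,\ell_{\lambda_2},\,\dots,\,1_{\lambda_L},\dots,\ell_{\lambda_L},\,q,\,p .$$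 **Definitions.** For a graph $H$ on $V$, let $P_H$ be the cone of positive definite matrices $K$ with $K_{ij}=0$ whenever $i\ne j$ are not adjacent in $H$, and let $$I_H(\delta,D)=\int_{P_H}|K|^{\frac{\delta-2}{2}}e^{-\frac12\operatorname{tr}(KD)}\,dK,$$ where $dK$ is the product of the Lebesgue measures $dK_{ij}$ over $i=j$ and over the edges $(i,j)$, $i<j$, of $H$. Let $K=\psi^t\psi$ be the Cholesky decomposition of $K\in P_H$, with $\psi$ upper triangular with positive diagonal. The entries $\psi_{ii}$, and $\psi_{ij}$ for the edges $(i,j)$, $i<j$, of $H$, are free; for $i<j$ not adjacent in $H$ the entry $\psi_{ij}$ is the function of the free entries determined by $(\psi^t\psi)_{ij}=0$, that is, $\psi_{ij}=-\frac{1}{\psi_{ii}}\sum_{r<i}\psi_{ri}\psi_{rj}$. Let $\mathbb{E}_H$ be the expectation under which all free entries are independent, $\psi_{ij}\sim N(0,1)$ for the edges of $H$, and $\psi_{ii}>0$ with $\psi_{ii}^2$ chi-square distributed with $\delta+\nu_i$ degrees of freedom, where $\nu_i$ is the number of neighbours $j>i$ of $i$ in $H$. Write $\bar E$ for the set of pairs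 $i<j$ that are not edges of $G$. **Statement.** The constants $I_G(\delta,\mathbb{I}_p)$ and $I_{G^{-e}}(\delta,\mathbb{I}_p)$ are finite and positive, the expectation in the denominator below is positive, and $$\frac{I_{G^{-e}}(\delta,\mathbb{I}_p)}{I_G(\delta,\mathbb{I}_p)}=\frac{1}{2\sqrt{\pi}}\,\frac{\Gamma(\delta/2)}{\Gamma((\delta+1)/2)}\;\frac{\mathbb{E}_{G^{-e}}\Big[\exp\Big(-\frac12\big(\sum_{(i,j)\in\bar E}\psi_{ij}^2+\psi_e^2\big)\Big)\Big]}{\mathbb{E}_{G}\Big[\exp\Big(-\frac12\sum_{(i,j)\in\bar E}\psi_{ij}^2\Big)\Big]},$$ where $$\psi_e=\sum_{\lambda\in\Lambda}(-1)^{\ell_\lambda}\frac{\prod_{a\in E_\lambda}\psi_a}{\psi_{qq}\prod_{v\in V_\lambda^{(-1)}}\psi_{vv}} .$$ Moreover, for every $K\in P_{G^{-e}}$ with Cholesky decomposition $K=\psi^t\psi$, the non-free entry $\psi_{qp}$ of $\psi$ equals this $\psi_e$. -/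

import Mathlib

open MeasureTheory ProbabilityTheory

noncomputable section

namespace GWishart

variable {V : Type*} [Fintype V] [LinearOrder V]

/-- The cone `P_G` of positive definite matrices `K` with `K i j = 0` whenever `i ≠ j` are not
adjacent in `G`. -/
def precisionCone (G : SimpleGraph V) : Set (Matrix V V ℝ) :=
  {K | K.PosDef ∧ ∀ i j, i ≠ j → ¬ G.Adj i j → K i j = 0}

open Classical in
/-- The symmetric matrix with diagonal entries `x.1`, entries `x.2` on the edges of `G`, and zeros
elsewhere. This is the coordinate chart of the space of symmetric matrices whose off-diagonal
support is contained in the edge set of `G`. -/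
def symMatrix (G : SimpleGraph V) (x : (V → ℝ) × (G.edgeSet → ℝ)) : Matrix V V ℝ :=
  Matrix.of fun i j =>
    if i = j then x.1 i
    else if h : G.Adj i j then x.2 ⟨s(i, j), h⟩
    else 0

open Classical in
/-- The normalizing constant `I_G(δ, D) = ∫_{P_G} |K|^{(δ-2)/2} exp (-⟨K, D⟩ / 2) dK`, where `dK`
is the product of the Lebesgue measures `dK_ij` over `i = j` and over the edges `{i, j}` of `G`. -/
def normConst (G : SimpleGraph V) (δ : ℝ) (D : Matrix V V ℝ) : ℝ :=
  ∫ x in {x : (V → ℝ) × (G.edgeSet → ℝ) | symMatrix G x ∈ precisionCone G},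
    (symMatrix G x).det ^ ((δ - 2) / 2) * Real.exp (-(1 / 2) * (symMatrix G x * D).trace)

open Classical in
/-- `ν_i`, the number of neighbours of `i` that come after `i` in the vertex order. -/
def nu (G : SimpleGraph V) (i : V) : ℕ :=
  (Finset.univ.filter fun j => i < j ∧ G.Adj i j).card

open Classical in
/-- The law of the free entries of the Cholesky factor: all entries are independent, the diagonal
entry `ψ_ii` is positive with `ψ_ii²` chi-square distributed with `δ + ν_i` degrees of freedom
(that is, Gamma with shape `(δ + ν_i) / 2` and rate `1 / 2`), and the entries on the edges of `G`
are standard normal. -/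
def freeLaw (G : SimpleGraph V) (δ : ℝ) : Measure ((V → ℝ) × (G.edgeSet → ℝ)) :=
  (Measure.pi fun i : V =>
      (gammaMeasure ((δ + (nu G i : ℝ)) / 2) (1 / 2)).map Real.sqrt).prod
    (Measure.pi fun _ : G.edgeSet => gaussianReal 0 1)

/-- `ψ` is the Cholesky factor of `K`: upper triangular with positive diagonal and `K = ψᵗ ψ`. -/
structure IsCholeskyFactor (ψ K : Matrix V V ℝ) : Prop where
  upper : ∀ i j, j < i → ψ i j = 0
  diag_pos : ∀ i, 0 < ψ i i
  eq : K = ψ.transpose * ψ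

open Classical in
/-- The upper triangular matrix with free entries `x` (`x.1` on the diagonal, `x.2` on the edges
of `G`) whose non-free entries are determined by the condition that `ψᵗ ψ` vanishes at the
non-edges of `G`, i.e. `ψ_ij = -(∑_{r < i} ψ_ri ψ_rj) / ψ_ii` for every non-edge `i < j`. -/
def cholFill (G : SimpleGraph V) (x : (V → ℝ) × (G.edgeSet → ℝ)) (i j : V) : ℝ :=
  if j < i then 0
  else if i = j then x.1 i
  else if h : G.Adj i j then x.2 ⟨s(i, j), h⟩
  else -(∑ r : {r : V // r < i}, cholFill G x r i * cholFill G x r j) / x.1 i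
termination_by wellFounded_lt.wrap i
decreasing_by all_goals exact r.2

/-- The entries of `ψᵗ ψ` on and above the diagonal, for an upper triangular `ψ`. -/
theorem gram_apply {ψ : Matrix V V ℝ} (hψ : ∀ i j, j < i → ψ i j = 0) (i j : V) :
    (ψ.transpose * ψ) i j = (∑ r : {r : V // r < i}, ψ r i * ψ r j) + ψ i i * ψ i j := by
  classical
  rw [Matrix.mul_apply]
  simp only [Matrix.transpose_apply]
  have h1 : (∑ r : {r : V // r < i}, ψ r i * ψ r j)
      = ∑ r ∈ Finset.univ.filter (fun r => r < i), ψ r i * ψ r j :=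
    (Finset.sum_subtype (p := fun r => r < i) _ (by simp) (fun r => ψ r i * ψ r j)).symm
  have h2 : ψ i i * ψ i j = ∑ r, if r = i then ψ r i * ψ r j else 0 := by simp
  rw [h1, h2, Finset.sum_filter, ← Finset.sum_add_distrib]
  refine Finset.sum_congr rfl fun r _ => ?_
  rcases lt_trichotomy r i with h | h | h
  · simp [h, h.ne]
  · simp [h]
  · simp [h.not_gt, h.ne', hψ r i h]

/-- For positive diagonal entries, the filled matrix is the Cholesky factor of an element of
`P_G`. -/
theorem cholFill_isCholeskyFactor (G : SimpleGraph V) (x : (V → ℝ) × (G.edgeSet → ℝ))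
    (hx : ∀ i, 0 < x.1 i) :
    ∃ K ∈ precisionCone G, IsCholeskyFactor (Matrix.of (cholFill G x)) K := by
  classical
  have hup : ∀ i j, j < i → Matrix.of (cholFill G x) i j = 0 := fun i j h => by
    rw [Matrix.of_apply, cholFill, if_pos h]
  have hdiag : ∀ i, Matrix.of (cholFill G x) i i = x.1 i := fun i => by
    rw [Matrix.of_apply, cholFill, if_neg (lt_irrefl i), if_pos rfl]
  have hzero : ∀ i j, i < j → ¬ G.Adj i j →
      ((Matrix.of (cholFill G x)).transpose * Matrix.of (cholFill G x)) i j = 0 := by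
    intro i j hij hG
    rw [gram_apply hup, hdiag]
    simp only [Matrix.of_apply]
    rw [cholFill.eq_def G x i j, if_neg hij.not_gt, if_neg hij.ne, dif_neg hG,
      mul_div_cancel₀ _ (hx i).ne', add_neg_cancel]
  refine ⟨_, ⟨?_, fun i j hij hG => ?_⟩, hup, fun i => (hdiag i).symm ▸ hx i, rfl⟩
  · have hdet : IsUnit (Matrix.of (cholFill G x)) := by
      rw [Matrix.isUnit_iff_isUnit_det,
        Matrix.det_of_isUpperTriangular (fun i j h => hup i j h), isUnit_iff_ne_zero]
      exact Finset.prod_ne_zero_iff.2 fun i _ => (hdiag i).symm ▸ (hx i).ne'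
    rw [← Matrix.conjTranspose_eq_transpose_of_trivial]
    exact Matrix.PosDef.conjTranspose_mul_self _ (Matrix.mulVec_injective_iff_isUnit.2 hdet)
  · rcases lt_or_gt_of_ne hij with h | h
    · exact hzero i j h hG
    · have := hzero j i h fun h' => hG h'.symm
      rw [← Matrix.transpose_apply (Matrix.transpose _ * _) i j, Matrix.transpose_mul,
        Matrix.transpose_transpose] at this
      exact this

/-- The filled matrix is the only Cholesky factor of an element of `P_G` with the given free
entries. -/
theorem eq_cholFill (G : SimpleGraph V) (x : (V → ℝ) × (G.edgeSet → ℝ))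
    {ψ K : Matrix V V ℝ} (hK : K ∈ precisionCone G) (hψ : IsCholeskyFactor ψ K)
    (hd : ∀ i, ψ i i = x.1 i)
    (he : ∀ i j, i < j → ∀ h : G.Adj i j, ψ i j = x.2 ⟨s(i, j), h⟩) (i j : V) :
    ψ i j = cholFill G x i j := by
  classical
  induction i using WellFoundedLT.induction generalizing j with
  | ind i ih =>
    rw [cholFill]
    split_ifs with h1 h2 h3
    · exact hψ.upper i j h1
    · rw [← h2, hd]
    · exact he i j (lt_of_le_of_ne (not_lt.1 h1) h2) h3
    · have h0 : K i j = 0 := hK.2 i j h2 h3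
      rw [hψ.eq, gram_apply hψ.upper, hd] at h0
      have hxi : x.1 i ≠ 0 := hd i ▸ (hψ.diag_pos i).ne'
      have hs : (∑ r : {r : V // r < i}, cholFill G x r i * cholFill G x r j)
          = ∑ r : {r : V // r < i}, ψ r i * ψ r j :=
        Finset.sum_congr rfl fun r _ => by rw [ih r.1 r.2 i, ih r.1 r.2 j]
      rw [eq_div_iff hxi, hs]
      linarith

/-- A minimal path: a path without a chord. -/
def IsMinimalPath {G : SimpleGraph V} {u v : V} (w : G.Walk u v) : Prop :=
  w.IsPath ∧ w.IsChordless

/-- The list of interior vertices `1_λ, …, ℓ_λ` of a path, in the order of the path. -/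
def interiorVertices {G : SimpleGraph V} {u v : V} (w : G.Walk u v) : List V :=
  w.support.tail.dropLast

/-- `G` consists of the vertices `q`, `p` and of the vertices and edges of the minimal paths
between `q` and `p`. -/
structure IsUnionOfMinimalPaths (G : SimpleGraph V) (q p : V) : Prop where
  vertices : ∀ v, v = q ∨ v = p ∨ ∃ w : G.Walk q p, IsMinimalPath w ∧ v ∈ w.support
  edges : ∀ a ∈ G.edgeSet, ∃ w : G.Walk q p, IsMinimalPath w ∧ a ∈ w.edges

/-- `lam 0, …, lam (L - 1)` is an enumeration without repetition of the minimal paths between `q`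
and `p`, with the paths of length 2 listed last, such that the vertex order is
`1_{λ_1}, …, ℓ_{λ_1}, …, 1_{λ_L}, …, ℓ_{λ_L}, q, p`. -/
structure IsAdaptedOrder (G : SimpleGraph V) (q p : V) {L : ℕ} (lam : Fin L → G.Walk q p) :
    Prop where
  injective : Function.Injective lam
  mem_iff : ∀ w : G.Walk q p, (∃ k, lam k = w) ↔ IsMinimalPath w
  short_last : ∀ k l, k ≤ l → (lam k).length = 2 → (lam l).length = 2
  sorted : ((List.ofFn fun k => interiorVertices (lam k)).flatten ++ [q, p]).Pairwise (· < ·)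

/-- The expression
`∑_λ (-1)^{ℓ_λ} ∏_{a ∈ E_λ} ψ_a / (ψ_qq ∏_{v ∈ V_λ ∖ {1_λ}} ψ_vv)`, where `ψ_a = ψ_ij` for an edge
`a = {i, j}` with `i < j`. -/
def pathSum {G : SimpleGraph V} {q p : V} {L : ℕ} (lam : Fin L → G.Walk q p)
    (ψ : V → V → ℝ) : ℝ :=
  ∑ k, (-1) ^ (interiorVertices (lam k)).length *
    ((lam k).edges.map fun a => ψ a.inf a.sup).prod /
      (ψ q q * ((interiorVertices (lam k)).tail.map fun v => ψ v v).prod)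

open Classical in
/-- `∑_{(i,j) ∈ Ē} ψ_ij²`, the sum over the non-edges `i < j` of `G`. -/
def nonEdgeSqSum (G : SimpleGraph V) (ψ : V → V → ℝ) : ℝ :=
  ∑ a ∈ Finset.univ.filter (fun a : V × V => a.1 < a.2 ∧ ¬ G.Adj a.1 a.2), ψ a.1 a.2 ^ 2

end GWishart

end

open GWishart

/-! The substitution `K = ψᵗ ψ` computes both normalizing constants. For any graph `H`, the free
entries of the Cholesky factor parametrize the cone `P_H` bijectively, with Jacobian `2^|V| ∏
ψ_ii^(ν_i + 1)`. Also `|K|^((δ-2)/2) = ∏ ψ_ii^(δ-2)`, and `tr K` is the sum of all `ψ_ij²`. The free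
entries thus contribute independent chi and Gaussian densities up to a constant for each vertex, and
only the squares of the non-free entries stay behind: `normConst_eq` writes `I_H(δ, 1)` as `∏
vertexConst δ ν_i` times `E_H[exp(-½ ∑ ψ_ij²)]`, summed over the non-edges of `H`.

In the ratio for `G` without `e` over `G`, only the constant at `q` changes: `p` is the sole vertex
above `q`, so `ν_q` drops from 1 to 0, which yields the Gamma quotient (`prod_vertexConst_ratio`).
The non-edges gain the pair `(q, p)`, so `ψ_qp²` joins the exponent.

It remains to solve for `ψ_qp` (`entry_eq_pathSum`). In the adapted order each interior vertex has
only its two path neighbours, and at most one of them is a later interior vertex. Elimination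
therefore creates no fill-in between interior vertices (`entry_eq_zero`). Among the rows above `q`,
column `p` is supported on the last interior vertices (`entry_end_eq_zero`), while column `q`
propagates along each path by a two-term recursion (`entry_start_mul_prod`). The equation `K_qp = 0`
then has one contribution per path. -/

open scoped ENNReal

/-! ### Products of measures with densities -/

/-- Integrating out one coordinate turns its factor into a constant; the arbitrary `c` absorbs that
constant in the induction. -/
theorem MeasureTheory.lmarginal_const_mul_prod {ι : Type*} [DecidableEq ι] {α : ι → Type*}
    [∀ i, MeasurableSpace (α i)] (μ : ∀ i, Measure (α i)) [∀ i, SigmaFinite (μ i)]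
    (f : ∀ i, α i → ℝ≥0∞) (hf : ∀ i, Measurable (f i)) (s : Finset ι) (c : ℝ≥0∞)
    (x : ∀ i, α i) :
    (∫⋯∫⁻_s, (fun x => c * ∏ i ∈ s, f i (x i)) ∂μ) x = c * ∏ i ∈ s, ∫⁻ t, f i t ∂μ i := by
  induction s using Finset.induction generalizing c with
  | empty => simp
  | insert i s hi ih =>
    rw [lmarginal_insert' _ (by fun_prop) hi, Finset.prod_insert hi, ← mul_assoc, ← ih]
    congr 1
    ext y
    have h : ∀ t, c * ∏ j ∈ insert i s, f j (Function.update y i t j) =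
        (c * ∏ j ∈ s, f j (y j)) * f i t := fun t => by
      rw [Finset.prod_insert hi, Function.update_self, mul_comm (f i t), mul_assoc]
      congr 2
      refine Finset.prod_congr rfl fun j hj => ?_
      rw [Function.update_of_ne (ne_of_mem_of_not_mem hj hi)]
    simp_rw [h]
    rw [lintegral_const_mul _ (hf i)]
    ring

theorem MeasureTheory.lintegral_fintype_prod_eq_prod {ι : Type*} [Fintype ι] {α : ι → Type*}
    [∀ i, MeasurableSpace (α i)] [∀ i, Nonempty (α i)] (μ : ∀ i, Measure (α i))
    [∀ i, SigmaFinite (μ i)] (f : ∀ i, α i → ℝ≥0∞) (hf : ∀ i, Measurable (f i)) :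
    ∫⁻ x, ∏ i, f i (x i) ∂Measure.pi μ = ∏ i, ∫⁻ t, f i t ∂μ i := by
  classical
  rw [lintegral_eq_lmarginal_univ fun i => Classical.arbitrary (α i)]
  simpa using lmarginal_const_mul_prod μ f hf Finset.univ 1 fun i => Classical.arbitrary (α i)

theorem MeasureTheory.Measure.pi_withDensity {ι : Type*} [Fintype ι] {α : ι → Type*}
    [∀ i, MeasurableSpace (α i)] [∀ i, Nonempty (α i)] (μ : ∀ i, Measure (α i))
    [∀ i, SigmaFinite (μ i)] (f : ∀ i, α i → ℝ≥0∞) (hf : ∀ i, Measurable (f i))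
    [∀ i, SigmaFinite ((μ i).withDensity (f i))] :
    Measure.pi (fun i => (μ i).withDensity (f i)) =
      (Measure.pi μ).withDensity fun x => ∏ i, f i (x i) := by
  refine Measure.pi_eq fun s hs => ?_
  rw [withDensity_apply _ (MeasurableSet.univ_pi hs), Measure.restrict_pi_pi,
    lintegral_fintype_prod_eq_prod _ f hf]
  exact Finset.prod_congr rfl fun i _ => (withDensity_apply _ (hs i)).symm

/-! ### Density of the law of the free entries -/

namespace GWishart

/-- The density of the square root of a Gamma variable with shape `a` and rate `1 / 2`. -/
noncomputable def chiPDF (a t : ℝ) : ℝ :=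
  2 * (1 / 2) ^ a / Real.Gamma a * (t ^ (2 * a - 1) * Real.exp (-(1 / 2) * t ^ 2))

theorem measurable_chiPDF (a : ℝ) : Measurable (chiPDF a) := by
  unfold chiPDF
  fun_prop

/-- Change of variables `x = t²` on the positive half-line, where squaring is injective with
derivative `2t`. -/
theorem map_sqrt_gammaMeasure (a : ℝ) :
    (gammaMeasure a (1 / 2)).map Real.sqrt =
      volume.withDensity ((Set.Ioi 0).indicator fun t => ENNReal.ofReal (chiPDF a t)) := by
  ext A hA
  have hA' : MeasurableSet (A ∩ Set.Ioi 0) := hA.inter measurableSet_Ioi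
  have himg : Real.sqrt ⁻¹' A ∩ Set.Ioi 0 = (fun t : ℝ => t ^ 2) '' (A ∩ Set.Ioi 0) := by
    ext x
    simp only [Set.mem_inter_iff, Set.mem_preimage, Set.mem_Ioi, Set.mem_image]
    constructor
    · rintro ⟨h1, h2⟩
      exact ⟨√x, ⟨h1, Real.sqrt_pos.2 h2⟩, Real.sq_sqrt h2.le⟩
    · rintro ⟨t, ⟨h1, h2⟩, rfl⟩
      exact ⟨by rwa [Real.sqrt_sq h2.le], by positivity⟩
  have hinj : Set.InjOn (fun t : ℝ => t ^ 2) (A ∩ Set.Ioi 0) := fun x hx y hy h =>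
    (pow_left_inj₀ (le_of_lt hx.2) (le_of_lt hy.2) two_ne_zero).1 h
  -- `Real.sqrt` sends negative numbers to 0, so the preimage of `A` may contain them; the Gamma
  -- density vanishes there, and the point 0 is null.
  have hsupp : ∫⁻ x in Real.sqrt ⁻¹' A, gammaPDF a (1 / 2) x =
      ∫⁻ x in Real.sqrt ⁻¹' A ∩ Set.Ioi 0, gammaPDF a (1 / 2) x := by
    rw [Set.inter_comm, ← setLIntegral_indicator measurableSet_Ioi]
    refine lintegral_congr_ae (ae_restrict_of_ae ?_)
    filter_upwards [Measure.ae_ne volume (0 : ℝ)] with x hx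
    rcases lt_or_gt_of_ne hx with h | h
    · rw [gammaPDF_of_neg h, Set.indicator_of_notMem (by simpa using h.le)]
    · rw [Set.indicator_of_mem (Set.mem_Ioi.2 h)]
  rw [Measure.map_apply Real.continuous_sqrt.measurable hA, gammaMeasure,
    withDensity_apply _ (Real.continuous_sqrt.measurable hA), hsupp, himg,
    lintegral_image_eq_lintegral_abs_deriv_mul hA'
      (fun x _ => (hasDerivAt_pow 2 x).hasDerivWithinAt) hinj,
    withDensity_apply _ hA, setLIntegral_indicator measurableSet_Ioi, Set.inter_comm]
  refine setLIntegral_congr_fun (measurableSet_Ioi.inter hA) fun t ht => ?_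
  have ht0 : 0 < t := ht.1
  rw [gammaPDF_of_nonneg (by positivity), ← ENNReal.ofReal_mul (abs_nonneg _)]
  congr 1
  have : (t ^ 2) ^ (a - 1) * t = t ^ (2 * a - 1) := by
    rw [← Real.rpow_natCast, ← Real.rpow_mul ht0.le]
    nth_rewrite 2 [← Real.rpow_one t]
    rw [← Real.rpow_add ht0]
    congr 1; push_cast; ring
  rw [chiPDF, ← this, abs_of_pos (by positivity)]
  simp only [neg_mul]
  push_cast
  ring

theorem chiPDF_nonneg {a t : ℝ} (ha : 0 < a) (ht : 0 < t) : 0 ≤ chiPDF a t := by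
  unfold chiPDF
  positivity

variable {V : Type*} [Fintype V] [LinearOrder V]

/-- The free coordinates with positive diagonal part. -/
def posDiag (G : SimpleGraph V) : Set ((V → ℝ) × (G.edgeSet → ℝ)) :=
  {x | ∀ i, 0 < x.1 i}

theorem measurableSet_posDiag (G : SimpleGraph V) : MeasurableSet (posDiag G) := by
  simp only [posDiag, Set.ofPred_forall]
  exact MeasurableSet.iInter fun i => measurableSet_lt measurable_const (by fun_prop)

open Classical in
/-- The density of the law of the free entries. -/
noncomputable def freeDensity (G : SimpleGraph V) (δ : ℝ) (x : (V → ℝ) × (G.edgeSet → ℝ)) : ℝ :=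
  (∏ i, chiPDF ((δ + nu G i) / 2) (x.1 i)) * ∏ a, gaussianPDFReal 0 1 (x.2 a)

theorem measurable_freeDensity (G : SimpleGraph V) (δ : ℝ) : Measurable (freeDensity G δ) := by
  classical
  have := fun i => measurable_chiPDF ((δ + nu G i) / 2)
  have := measurable_gaussianPDFReal 0 1
  unfold freeDensity
  fun_prop

theorem isProbabilityMeasure_map_sqrt {a : ℝ} (ha : 0 < a) :
    IsProbabilityMeasure ((gammaMeasure a (1 / 2)).map Real.sqrt) :=
  have := isProbabilityMeasure_gammaMeasure ha (show (0 : ℝ) < 1 / 2 by norm_num)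
  Measure.isProbabilityMeasure_map Real.continuous_sqrt.aemeasurable

theorem isProbabilityMeasure_freeLaw (G : SimpleGraph V) {δ : ℝ} (hδ : 0 < δ) :
    IsProbabilityMeasure (freeLaw G δ) := by
  classical
  have := fun i => isProbabilityMeasure_map_sqrt (a := (δ + nu G i) / 2) (by positivity)
  unfold freeLaw
  infer_instance

open Classical in
theorem freeLaw_eq_withDensity (G : SimpleGraph V) {δ : ℝ} (hδ : 0 < δ) :
    freeLaw G δ = (volume.restrict (posDiag G)).withDensity
      fun x => ENNReal.ofReal (freeDensity G δ x) := by
  have hprob := fun i => isProbabilityMeasure_map_sqrt (a := (δ + nu G i) / 2) (by positivity)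
  have hg : gaussianReal 0 1 = volume.withDensity (gaussianPDF 0 1) :=
    gaussianReal_of_var_ne_zero 0 one_ne_zero
  have hgm : Measurable (gaussianPDF 0 1) := measurable_gaussianPDF 0 1
  have hm : ∀ a : ℝ, Measurable ((Set.Ioi (0 : ℝ)).indicator
      fun t => ENNReal.ofReal (chiPDF a t)) := fun a =>
    ((measurable_chiPDF a).ennreal_ofReal).indicator measurableSet_Ioi
  have hgp : IsProbabilityMeasure (volume.withDensity (gaussianPDF 0 1)) := hg ▸ inferInstance
  simp_rw [map_sqrt_gammaMeasure] at hprob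
  rw [freeLaw]
  simp_rw [map_sqrt_gammaMeasure, hg]
  rw [Measure.pi_withDensity _ _ fun i => hm _, Measure.pi_withDensity _ _ fun _ => hgm,
    prod_withDensity (by fun_prop) (by fun_prop), ← withDensity_indicator (measurableSet_posDiag G)]
  congr 1
  ext x
  by_cases hx : x ∈ posDiag G
  · rw [Set.indicator_of_mem hx, freeDensity, ENNReal.ofReal_mul
      (Finset.prod_nonneg fun i _ => chiPDF_nonneg (by positivity) (hx i)),
      ENNReal.ofReal_prod_of_nonneg fun i _ => chiPDF_nonneg (by positivity) (hx i),
      ENNReal.ofReal_prod_of_nonneg fun i _ => gaussianPDFReal_nonneg _ _ _]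
    congr 1
    exact Finset.prod_congr rfl fun i _ => Set.indicator_of_mem (hx i) _
  · rw [Set.indicator_of_notMem hx]
    obtain ⟨i, hi⟩ := not_forall.1 hx
    rw [Finset.prod_eq_zero (Finset.mem_univ i), zero_mul]
    exact Set.indicator_of_notMem hi _

end GWishart

/-! ### Cholesky parametrization of the cone -/

namespace GWishart

variable {V : Type*} [LinearOrder V]

/-- The coordinates of a symmetric matrix in the chart `symMatrix`. -/
def coords (G : SimpleGraph V) (K : Matrix V V ℝ) : (V → ℝ) × (G.edgeSet → ℝ) :=
  (fun i => K i i, fun a => K a.1.inf a.1.sup)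

theorem symMatrix_coords (G : SimpleGraph V) {K : Matrix V V ℝ} (hs : K.IsSymm)
    (hK : ∀ i j, i ≠ j → ¬ G.Adj i j → K i j = 0) : symMatrix G (coords G K) = K := by
  classical
  ext i j
  simp only [symMatrix, coords, Matrix.of_apply]
  split_ifs with h1 h2
  · rw [h1]
  · rcases lt_or_gt_of_ne h1 with h | h
    · simp [h.le]
    · simpa [h.le] using hs.apply i j
  · exact (hK i j h1 h2).symm

theorem inf_lt_sup (G : SimpleGraph V) (a : G.edgeSet) : a.1.inf < a.1.sup := by
  obtain ⟨⟨i, j⟩, h⟩ := a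
  have : i ≠ j := G.ne_of_adj h
  simpa [eq_comm] using this

theorem adj_inf_sup (G : SimpleGraph V) (a : G.edgeSet) : G.Adj a.1.inf a.1.sup := by
  obtain ⟨⟨i, j⟩, h⟩ := a
  have h' : G.Adj i j := h
  rcases le_total i j with h | h
  · simpa [h] using h'
  · simpa [h] using h'.symm

theorem mk_inf_sup (a : Sym2 V) : s(a.inf, a.sup) = a := by
  induction a with
  | h i j =>
  rcases le_total i j with h | h
  · simp [h]
  · simp [h, Sym2.eq_swap]

theorem coords_symMatrix (G : SimpleGraph V) (x : (V → ℝ) × (G.edgeSet → ℝ)) :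
    coords G (symMatrix G x) = x := by
  classical
  ext a
  · simp [coords, symMatrix]
  · simp [coords, symMatrix, adj_inf_sup, (inf_lt_sup G a).ne, mk_inf_sup]

variable [Fintype V]

theorem exists_isCholeskyFactor {K : Matrix V V ℝ} (hK : K.PosDef) :
    ∃ ψ, IsCholeskyFactor ψ K := by
  classical
  let _ : LocallyFiniteOrderBot V := LocallyFiniteOrderBot.ofIic V
    (fun a => Finset.univ.filter (· ≤ a)) (by simp)
  let N := LDL.lower hK
  let d := LDL.diagEntries hK
  have hNd : N * Matrix.diagonal d * N.transpose = K := by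
    rw [← Matrix.conjTranspose_eq_transpose_of_trivial]
    exact LDL.lower_conj_diag hK
  have hinv : Invertible (LDL.lowerInv hK) := inferInstance
  have htri : (LDL.lowerInv hK).BlockTriangular OrderDual.toDual :=
    fun i j h => LDL.lowerInv_triangular hK h
  have hNtri : N.BlockTriangular OrderDual.toDual :=
    Matrix.blockTriangular_inv_of_blockTriangular htri
  have hNdet : N.det ≠ 0 := by
    have : IsUnit N.det := by
      have := Matrix.isUnit_det_of_invertible (LDL.lowerInv hK)
      exact Matrix.isUnit_nonsing_inv_det _ this
    exact this.ne_zero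
  have hNdiag : ∀ i, N i i ≠ 0 := by
    rw [Matrix.det_of_isLowerTriangular _ hNtri] at hNdet
    exact fun i => Finset.prod_ne_zero_iff.1 hNdet i (Finset.mem_univ i)
  have hdpos : ∀ i, 0 < d i := by
    have h1 : (Matrix.diagonal d).PosDef := by
      change (LDL.diag hK).PosDef
      rw [LDL.diag_eq_lowerInv_conj]
      exact hK.mul_mul_conjTranspose_same
        (Matrix.vecMul_injective_iff_isUnit.2 (isUnit_of_invertible _))
    exact Matrix.posDef_diagonal_iff.1 h1
  -- The sign makes the diagonal of the factor positive and cancels in `c i * c i`, so only `N i i ≠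
  -- 0` is needed.
  let c : V → ℝ := fun i => SignType.sign (N i i) * √(d i)
  have hc : ∀ i, c i * c i = d i := fun i => by
    have h1 : ((SignType.sign (N i i) : ℝ)) * (SignType.sign (N i i) : ℝ) = 1 := by
      rcases lt_or_gt_of_ne (hNdiag i) with h | h
      · simp [sign_neg h]
      · simp [sign_pos h]
    calc c i * c i = ((SignType.sign (N i i) : ℝ) * (SignType.sign (N i i) : ℝ))
          * (√(d i) * √(d i)) := by ring
      _ = d i := by rw [h1, Real.mul_self_sqrt (hdpos i).le, one_mul]
  refine ⟨Matrix.diagonal c * N.transpose, fun i j h => ?_, fun i => ?_, ?_⟩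
  · rw [Matrix.diagonal_mul, Matrix.transpose_apply, hNtri h, mul_zero]
  · rw [Matrix.diagonal_mul, Matrix.transpose_apply, mul_right_comm, sign_mul_self]
    exact mul_pos (abs_pos.2 (hNdiag i)) (Real.sqrt_pos.2 (hdpos i))
  · rw [Matrix.transpose_mul, Matrix.transpose_transpose, Matrix.diagonal_transpose,
      Matrix.mul_assoc, ← Matrix.mul_assoc (Matrix.diagonal c), Matrix.diagonal_mul_diagonal,
      ← Matrix.mul_assoc, ← hNd]
    simp_rw [hc]

/-- Row by row: once the earlier rows agree, row `i` of `K` determines the products `ψ_ii ψ_ij`; the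
case `j = i` gives the positive root `ψ_ii`, by which one divides. -/
theorem IsCholeskyFactor.unique {ψ ψ' K : Matrix V V ℝ} (h : IsCholeskyFactor ψ K)
    (h' : IsCholeskyFactor ψ' K) : ψ = ψ' := by
  ext i j
  induction i using WellFoundedLT.induction generalizing j with
  | ind i ih =>
    have key : ∀ j, ψ i i * ψ i j = ψ' i i * ψ' i j := fun j => by
      have h1 := gram_apply h.upper i j
      have h2 := gram_apply h'.upper i j
      rw [← h.eq] at h1
      rw [← h'.eq] at h2
      have h3 : (∑ r : {r : V // r < i}, ψ r i * ψ r j) = ∑ r : {r : V // r < i}, ψ' r i * ψ' r j :=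
        Finset.sum_congr rfl fun r _ => by rw [ih r.1 r.2, ih r.1 r.2]
      linarith
    have hd : ψ i i = ψ' i i := by
      have := key i
      rwa [mul_self_inj (h.diag_pos i).le (h'.diag_pos i).le] at this
    have := key j
    rw [← hd] at this
    exact mul_left_cancel₀ (h.diag_pos i).ne' this

theorem cholFill_of_lt (G : SimpleGraph V) (x : (V → ℝ) × (G.edgeSet → ℝ)) {i j : V} (h : j < i) :
    cholFill G x i j = 0 := by
  rw [cholFill, if_pos h]

theorem cholFill_self (G : SimpleGraph V) (x : (V → ℝ) × (G.edgeSet → ℝ)) (i : V) :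
    cholFill G x i i = x.1 i := by
  rw [cholFill, if_neg (lt_irrefl i), if_pos rfl]

theorem cholFill_inf_sup (G : SimpleGraph V) (x : (V → ℝ) × (G.edgeSet → ℝ)) (a : G.edgeSet) :
    cholFill G x a.1.inf a.1.sup = x.2 a := by
  have := inf_lt_sup G a
  rw [cholFill, if_neg this.not_gt, if_neg this.ne, dif_pos (adj_inf_sup G a)]
  simp [mk_inf_sup]

theorem cholFill_of_not_adj (G : SimpleGraph V) (x : (V → ℝ) × (G.edgeSet → ℝ)) {i j : V}
    (h : i < j) (hG : ¬ G.Adj i j) : cholFill G x i j =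
      -(∑ r : {r : V // r < i}, cholFill G x r i * cholFill G x r j) / x.1 i := by
  rw [cholFill, if_neg h.not_gt, if_neg h.ne, dif_neg hG]

theorem coords_cholFill (G : SimpleGraph V) (x : (V → ℝ) × (G.edgeSet → ℝ)) :
    coords G (Matrix.of (cholFill G x)) = x := by
  classical
  ext a
  · exact cholFill_self G x a
  · exact cholFill_inf_sup G x a

/-- The change of variables from the free entries of the Cholesky factor to the precision
matrix. -/
noncomputable def cholMap (G : SimpleGraph V) (x : (V → ℝ) × (G.edgeSet → ℝ)) :
    (V → ℝ) × (G.edgeSet → ℝ) :=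
  coords G ((Matrix.of (cholFill G x)).transpose * Matrix.of (cholFill G x))

theorem symMatrix_cholMap (G : SimpleGraph V) {x : (V → ℝ) × (G.edgeSet → ℝ)}
    (hx : x ∈ posDiag G) : symMatrix G (cholMap G x) =
      (Matrix.of (cholFill G x)).transpose * Matrix.of (cholFill G x) := by
  obtain ⟨K, hK, h⟩ := cholFill_isCholeskyFactor G x hx
  rw [cholMap, ← h.eq]
  exact symMatrix_coords G (by simpa [Matrix.IsHermitian, Matrix.IsSymm] using hK.1.isHermitian) hK.2

theorem injOn_cholMap (G : SimpleGraph V) : Set.InjOn (cholMap G) (posDiag G) := by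
  intro x hx y hy hxy
  obtain ⟨K, hK, h⟩ := cholFill_isCholeskyFactor G x hx
  obtain ⟨K', hK', h'⟩ := cholFill_isCholeskyFactor G y hy
  have : K = K' := by rw [h.eq, h'.eq, ← symMatrix_cholMap G hx, ← symMatrix_cholMap G hy, hxy]
  subst this
  rw [← coords_cholFill G x, ← coords_cholFill G y, h.unique h']

theorem IsCholeskyFactor.eq_cholFill_coords {G : SimpleGraph V} {ψ K : Matrix V V ℝ}
    (h : IsCholeskyFactor ψ K) (hK : K ∈ precisionCone G) :
    ψ = Matrix.of (cholFill G (coords G ψ)) := by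
  ext i j
  refine eq_cholFill G _ hK h (fun _ => rfl) (fun i j hij hG => ?_) i j
  simp [coords, hij.le]

theorem image_cholMap (G : SimpleGraph V) :
    cholMap G '' posDiag G = {x | symMatrix G x ∈ precisionCone G} := by
  ext y
  constructor
  · rintro ⟨x, hx, rfl⟩
    obtain ⟨K, hK, h⟩ := cholFill_isCholeskyFactor G x hx
    change symMatrix G _ ∈ precisionCone G
    rwa [symMatrix_cholMap G hx, ← h.eq]
  · intro hy
    obtain ⟨ψ, hψ⟩ := exists_isCholeskyFactor hy.1
    refine ⟨coords G ψ, fun i => hψ.diag_pos i, ?_⟩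
    rw [cholMap, ← hψ.eq_cholFill_coords hy, ← hψ.eq, coords_symMatrix]

theorem det_symMatrix_cholMap (G : SimpleGraph V) {x : (V → ℝ) × (G.edgeSet → ℝ)}
    (hx : x ∈ posDiag G) : (symMatrix G (cholMap G x)).det = (∏ i, x.1 i) ^ 2 := by
  obtain ⟨K, hK, h⟩ := cholFill_isCholeskyFactor G x hx
  rw [symMatrix_cholMap G hx, Matrix.det_mul, Matrix.det_transpose,
    Matrix.det_of_isUpperTriangular (fun i j hij => h.upper i j hij), ← sq]
  refine congrArg (fun y : ℝ => y ^ 2) (Finset.prod_congr rfl fun i _ => ?_)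
  rw [Matrix.of_apply, cholFill_self]

/-- The edges of `G` as ordered pairs. -/
def edgePairs (G : SimpleGraph V) : G.edgeSet ≃ {a : V × V // a.1 < a.2 ∧ G.Adj a.1 a.2} where
  toFun a := ⟨(a.1.inf, a.1.sup), inf_lt_sup G a, adj_inf_sup G a⟩
  invFun a := ⟨s(a.1.1, a.1.2), a.2.2⟩
  left_inv a := Subtype.ext (mk_inf_sup a.1)
  right_inv a := by
    have := a.2.1.le
    ext <;> simp [this]

open Classical in
theorem sum_edgeSet (G : SimpleGraph V) {M : Type*} [AddCommMonoid M] (f : V → V → M) :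
    ∑ a : G.edgeSet, f a.1.inf a.1.sup =
      ∑ a ∈ Finset.univ.filter (fun a : V × V => a.1 < a.2 ∧ G.Adj a.1 a.2), f a.1 a.2 := by
  rw [Finset.sum_subtype _ (p := fun a : V × V => a.1 < a.2 ∧ G.Adj a.1 a.2) (by simp)]
  exact Fintype.sum_equiv (edgePairs G) _ _ fun _ => rfl

-- Each edge is charged to its smaller endpoint, and `i` is charged `ν_i` times. This turns products
-- over edges into products over vertices.
open Classical in
theorem prod_edgeSet_inf (G : SimpleGraph V) (f : V → ℝ) :
    ∏ a : G.edgeSet, f a.1.inf = ∏ i, f i ^ nu G i := by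
  have h : ∏ a : G.edgeSet, f a.1.inf =
      ∏ a ∈ Finset.univ.filter (fun a : V × V => a.1 < a.2 ∧ G.Adj a.1 a.2), f a.1 := by
    rw [Finset.prod_subtype _ (p := fun a : V × V => a.1 < a.2 ∧ G.Adj a.1 a.2) (by simp)]
    exact Fintype.prod_equiv (edgePairs G) _ _ fun _ => rfl
  rw [h, Finset.prod_filter, Fintype.prod_prod_type]
  refine Finset.prod_congr rfl fun i _ => ?_
  dsimp only
  rw [← Finset.prod_filter, Finset.prod_const, nu]

-- The trace of `ψᵗ ψ` is the sum of the squares of all entries of `ψ`, split into diagonal, edges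
-- and non-edges.
open Classical in
theorem trace_symMatrix_cholMap (G : SimpleGraph V) {x : (V → ℝ) × (G.edgeSet → ℝ)}
    (hx : x ∈ posDiag G) : (symMatrix G (cholMap G x)).trace =
      ∑ i, x.1 i ^ 2 + ∑ a, x.2 a ^ 2 + nonEdgeSqSum G (cholFill G x) := by
  have h1 : ∑ i, x.1 i ^ 2 =
      ∑ a : V × V, if a.1 = a.2 then cholFill G x a.1 a.2 ^ 2 else 0 := by
    rw [Fintype.sum_prod_type]
    simp [cholFill_self]
  have h2 : ∑ a, x.2 a ^ 2 =
      ∑ a : V × V, if a.1 < a.2 ∧ G.Adj a.1 a.2 then cholFill G x a.1 a.2 ^ 2 else 0 := by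
    rw [← Finset.sum_filter, ← sum_edgeSet G fun i j => cholFill G x i j ^ 2]
    simp_rw [cholFill_inf_sup]
  rw [symMatrix_cholMap G hx, Matrix.trace, h1, h2, nonEdgeSqSum, Finset.sum_filter,
    ← Finset.sum_add_distrib, ← Finset.sum_add_distrib, Fintype.sum_prod_type_right]
  refine Finset.sum_congr rfl fun j _ => ?_
  rw [Matrix.diag_apply, Matrix.mul_apply]
  refine Finset.sum_congr rfl fun i _ => ?_
  simp only [Matrix.transpose_apply, Matrix.of_apply]
  rcases lt_trichotomy i j with h | h | h
  · by_cases hG : G.Adj i j <;> simp [h, h.ne, hG, sq]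
  · simp [h, sq]
  · simp [h.not_gt, h.ne', cholFill_of_lt G x h]

end GWishart

/-! ### Jacobian of the Cholesky map -/

theorem Matrix.det_of_injective_of_lt {m α R : Type*} [Fintype m] [DecidableEq m] [LinearOrder α]
    [CommRing R] (M : Matrix m m R) {b : m → α} (hb : Function.Injective b)
    (h : ∀ i j, b i < b j → M i j = 0) : M.det = ∏ i, M i i := by
  let _ : LinearOrder m := LinearOrder.lift' b hb
  exact Matrix.det_of_isLowerTriangular M fun i j hij => h i j hij

namespace GWishart

variable {V : Type*} [LinearOrder V]

/-- The position `(i, j)`, `i ≤ j`, of a free coordinate, in the lexicographic order. -/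
def position (G : SimpleGraph V) : V ⊕ G.edgeSet → V ×ₗ V :=
  Sum.elim (fun i => toLex (i, i)) fun a => toLex (a.1.inf, a.1.sup)

theorem position_injective (G : SimpleGraph V) : Function.Injective (position G) := by
  rintro (i | a) (j | b) h <;> simp only [position, Sum.elim_inl, Sum.elim_inr, toLex_inj,
    Prod.mk.injEq] at h
  · rw [h.1]
  · exact absurd (h.1.symm.trans h.2) (inf_lt_sup G b).ne
  · exact absurd (h.1.trans h.2.symm) (inf_lt_sup G a).ne
  · rw [Subtype.ext (a1 := a) (a2 := b) (by rw [← mk_inf_sup a.1, h.1, h.2, mk_inf_sup])]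

variable [Fintype V]

/-- The free coordinates as linear functionals. -/
noncomputable def coordinate (G : SimpleGraph V) :
    V ⊕ G.edgeSet → ((V → ℝ) × (G.edgeSet → ℝ)) →L[ℝ] ℝ :=
  Sum.elim (fun i => (ContinuousLinearMap.proj i).comp (ContinuousLinearMap.fst ℝ _ _))
    fun a => (ContinuousLinearMap.proj a).comp (ContinuousLinearMap.snd ℝ _ _)

/-- An entry of the filled matrix only depends on the free coordinates up to its position. -/
theorem cholFill_congr (G : SimpleGraph V) {x y : (V → ℝ) × (G.edgeSet → ℝ)} (i j : V)
    (h : ∀ a, position G a ≤ toLex (i, j) → coordinate G a x = coordinate G a y) :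
    cholFill G x i j = cholFill G y i j := by
  induction i using WellFoundedLT.induction generalizing j with
  | ind i ih =>
    rcases lt_trichotomy i j with hij | rfl | hij
    · by_cases hG : G.Adj i j
      · have := h (Sum.inr ⟨s(i, j), hG⟩) (by simp [position, hij.le])
        have h1 := cholFill_inf_sup G x ⟨s(i, j), hG⟩
        have h2 := cholFill_inf_sup G y ⟨s(i, j), hG⟩
        simp only [Sym2.inf_mk, Sym2.sup_mk, inf_of_le_left hij.le, sup_of_le_right hij.le] at h1 h2
        rw [h1, h2]
        exact this
      · have hi : x.1 i = y.1 i := h (Sum.inl i) (Prod.Lex.toLex_le_toLex.2 (Or.inr ⟨rfl, hij.le⟩))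
        have hlt : ∀ r < i, ∀ k, ∀ a, position G a ≤ toLex (r, k) →
            coordinate G a x = coordinate G a y := fun r hr k a ha =>
          h a (ha.trans (Prod.Lex.toLex_le_toLex.2 (Or.inl hr)))
        rw [cholFill_of_not_adj G x hij hG, cholFill_of_not_adj G y hij hG, hi]
        congr 2
        exact Finset.sum_congr rfl fun r _ => by
          rw [ih r r.2 i (hlt r r.2 i), ih r r.2 j (hlt r r.2 j)]
    · rw [cholFill_self, cholFill_self]
      exact h (Sum.inl i) (by simp [position])
    · rw [cholFill_of_lt G x hij, cholFill_of_lt G y hij]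

open Classical in
theorem differentiableAt_cholFill (G : SimpleGraph V) {x : (V → ℝ) × (G.edgeSet → ℝ)}
    (hx : x ∈ posDiag G) (i j : V) : DifferentiableAt ℝ (fun x => cholFill G x i j) x := by
  induction i using WellFoundedLT.induction generalizing j with
  | ind i ih =>
    rcases lt_trichotomy i j with hij | rfl | hij
    · by_cases hG : G.Adj i j
      · have h1 := fun x => cholFill_inf_sup G x ⟨s(i, j), hG⟩
        simp only [Sym2.inf_mk, Sym2.sup_mk, inf_of_le_left hij.le, sup_of_le_right hij.le] at h1
        simp_rw [h1]
        fun_prop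
      · simp_rw [cholFill_of_not_adj G _ hij hG, div_eq_mul_inv]
        have : ∀ r : {r // r < i}, ∀ k, DifferentiableAt ℝ (fun x => cholFill G x r k) x :=
          fun r k => ih r r.2 k
        have h0 : DifferentiableAt ℝ (fun x : (V → ℝ) × (G.edgeSet → ℝ) => x.1 i) x := by fun_prop
        have h1 : DifferentiableAt ℝ (fun x => -∑ r : {r // r < i},
            cholFill G x r i * cholFill G x r j) x :=
          (DifferentiableAt.fun_sum fun r _ => (this r i).mul (this r j)).neg
        exact h1.fun_mul (h0.fun_inv (hx i).ne')
    · simp_rw [cholFill_self]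
      fun_prop
    · simp_rw [cholFill_of_lt G _ hij]
      fun_prop

theorem measurable_cholFill (G : SimpleGraph V) (i j : V) :
    Measurable fun x => cholFill G x i j := by
  induction i using WellFoundedLT.induction generalizing j with
  | ind i ih =>
    rcases lt_trichotomy i j with hij | rfl | hij
    · by_cases hG : G.Adj i j
      · have h1 := fun x => cholFill_inf_sup G x ⟨s(i, j), hG⟩
        simp only [Sym2.inf_mk, Sym2.sup_mk, inf_of_le_left hij.le, sup_of_le_right hij.le] at h1
        simp_rw [h1]
        fun_prop
      · simp_rw [cholFill_of_not_adj G _ hij hG]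
        have : ∀ r : {r // r < i}, ∀ k, Measurable (fun x => cholFill G x r k) :=
          fun r k => ih r r.2 k
        exact (Finset.measurable_fun_sum _ fun r _ => (this r i).mul (this r j)).neg.div
          (by fun_prop)
    · simp_rw [cholFill_self]
      fun_prop
    · simp_rw [cholFill_of_lt G _ hij]
      fun_prop

theorem gram_cholFill (G : SimpleGraph V) (x : (V → ℝ) × (G.edgeSet → ℝ)) (i j : V) :
    ((Matrix.of (cholFill G x)).transpose * Matrix.of (cholFill G x)) i j =
      (∑ r : {r : V // r < i}, cholFill G x r i * cholFill G x r j) + x.1 i * cholFill G x i j := by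
  rw [gram_apply (ψ := Matrix.of (cholFill G x)) fun i j h => cholFill_of_lt G x h, Matrix.of_apply, cholFill_self]
  simp only [Matrix.of_apply]

open Classical in
theorem differentiableAt_cholMap (G : SimpleGraph V) {x : (V → ℝ) × (G.edgeSet → ℝ)}
    (hx : x ∈ posDiag G) : DifferentiableAt ℝ (cholMap G) x := by
  have h : ∀ i j, DifferentiableAt ℝ (fun x =>
      ((Matrix.of (cholFill G x)).transpose * Matrix.of (cholFill G x)) i j) x := fun i j => by
    simp_rw [gram_cholFill]
    have := differentiableAt_cholFill G hx
    fun_prop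
  exact (differentiableAt_pi.2 fun i => h i i).prodMk
    (differentiableAt_pi.2 fun a : G.edgeSet => h a.1.inf a.1.sup)

/-- The coordinate at position `(i, j)` of `cholMap`, as a function of the `(i, j)` entry. -/
theorem coordinate_cholMap (G : SimpleGraph V) (a : V ⊕ G.edgeSet)
    (x : (V → ℝ) × (G.edgeSet → ℝ)) :
    coordinate G a (cholMap G x) =
      (∑ r : {r : V // r < (ofLex (position G a)).1}, cholFill G x r (ofLex (position G a)).1 *
        cholFill G x r (ofLex (position G a)).2) +
        x.1 (ofLex (position G a)).1 * coordinate G a x := by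
  rcases a with i | a
  · refine (gram_cholFill G x i i).trans ?_
    rw [cholFill_self]
    rfl
  · refine (gram_cholFill G x a.1.inf a.1.sup).trans ?_
    rw [cholFill_inf_sup]
    rfl

/-- The diagonal entries of the Jacobian matrix of `cholMap`. -/
noncomputable def jacobianDiag (G : SimpleGraph V) (x : (V → ℝ) × (G.edgeSet → ℝ)) :
    V ⊕ G.edgeSet → ℝ :=
  Sum.elim (fun i => 2 * x.1 i) fun a => x.1 a.1.inf

-- With positions ordered lexicographically the Jacobian matrix is lower triangular: `K_ij` is `ψ_ii
-- ψ_ij` plus terms from earlier rows. The diagonal is `2 ψ_ii` at `(i, i)` and `ψ_ii` at an edge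
-- `(i, j)`, and row `i` holds `ν_i` edges.
open Classical in
theorem det_fderiv_cholMap (G : SimpleGraph V) {x : (V → ℝ) × (G.edgeSet → ℝ)}
    (hx : x ∈ posDiag G) :
    (fderiv ℝ (cholMap G) x).det = 2 ^ Fintype.card V * ∏ i, x.1 i ^ (nu G i + 1) := by
  let B : Module.Basis (V ⊕ G.edgeSet) ℝ ((V → ℝ) × (G.edgeSet → ℝ)) :=
    (Pi.basisFun ℝ V).prod (Pi.basisFun ℝ G.edgeSet)
  have hrepr : ∀ a y, B.repr y a = coordinate G a y := by
    rintro (i | a) y <;> simp [B, coordinate]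
  have hB : ∀ a b, coordinate G a (B b) = if a = b then 1 else 0 := fun a b => by
    rw [← hrepr, Module.Basis.repr_self, Finsupp.single_apply]
    simp only [eq_comm]
  -- Each matrix entry is the derivative of a function of one real variable, so it can be identified
  -- by uniqueness of derivatives.
  have hderiv : ∀ a b, HasDerivAt (fun t : ℝ => coordinate G a (cholMap G (x + t • B b)))
      (LinearMap.toMatrix B B (fderiv ℝ (cholMap G) x) a b) 0 := fun a b => by
    rw [LinearMap.toMatrix_apply, hrepr]
    exact (coordinate G a).hasFDerivAt.comp_hasDerivAt (0 : ℝ)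
      ((differentiableAt_cholMap G hx).hasFDerivAt.hasLineDerivAt (B b))
  -- Entries in rows `r < i` depend only on coordinates strictly before `(i, j)`, hence not on
  -- coordinate `b`.
  have hsum : ∀ a b, position G a ≤ position G b → ∀ t : ℝ,
      (∑ r : {r : V // r < (ofLex (position G a)).1},
        cholFill G (x + t • B b) r (ofLex (position G a)).1 *
          cholFill G (x + t • B b) r (ofLex (position G a)).2) =
      ∑ r : {r : V // r < (ofLex (position G a)).1},
        cholFill G x r (ofLex (position G a)).1 * cholFill G x r (ofLex (position G a)).2 := by
    intro a b hab t
    have h : ∀ r : {r : V // r < (ofLex (position G a)).1}, ∀ k,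
        cholFill G (x + t • B b) r k = cholFill G x r k := fun r k => by
      refine cholFill_congr G _ _ fun c hc => ?_
      have hcb : position G c < position G b := (hc.trans_lt
        ((Prod.Lex.toLex_lt_toLex (y := ofLex (position G a))).2 (Or.inl r.2))).trans_le hab
      have hne : c ≠ b := fun h => hcb.ne (congrArg _ h)
      simp [hB, hne]
    simp_rw [h]
  have hfst : ∀ a b, position G a < position G b → (B b).1 (ofLex (position G a)).1 = 0 := by
    intro a b hab
    have : position G (Sum.inl (ofLex (position G a)).1) ≤ position G a := by
      refine (Prod.Lex.toLex_le_toLex (y := ofLex (position G a))).2 (Or.inr ⟨rfl, ?_⟩)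
      rcases a with i | a
      · exact le_rfl
      · exact (inf_lt_sup G a).le
    refine (hB (Sum.inl _) b).trans (if_neg fun h => ?_)
    rw [h] at this
    exact this.not_gt hab
  have htri : ∀ a b, position G a < position G b →
      LinearMap.toMatrix B B (fderiv ℝ (cholMap G) x) a b = 0 := by
    intro a b hab
    have hne : a ≠ b := fun h => hab.ne (congrArg _ h)
    refine (hderiv a b).unique ?_
    simp_rw [coordinate_cholMap, hsum a b hab.le]
    simp [hfst a b hab, hB, hne, hasDerivAt_const]
  have hdiag : ∀ a, LinearMap.toMatrix B B (fderiv ℝ (cholMap G) x) a a = jacobianDiag G x a := by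
    intro a
    refine (hderiv a a).unique ?_
    simp_rw [coordinate_cholMap, hsum a a le_rfl]
    refine HasDerivAt.const_add _ ?_
    have h1 : HasDerivAt (fun t : ℝ => coordinate G a (x + t • B a)) 1 0 := by
      have h : ∀ t : ℝ, coordinate G a (x + t • B a) = coordinate G a x + t := by simp [hB]
      simp_rw [h]
      exact (hasDerivAt_id (0 : ℝ)).const_add _
    rcases a with i | a
    -- At a diagonal position both factors are the same coordinate, whence the 2.
    · refine (h1.mul h1).congr_deriv ?_
      rw [zero_smul, add_zero, one_mul, mul_one, ← two_mul]
      rfl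
    · have h2 : (B (Sum.inr a)).1 = 0 := by simp [B]
      have := h1.const_mul (x.1 a.1.inf)
      simpa [h2, jacobianDiag, position] using this
  rw [ContinuousLinearMap.det, ← LinearMap.det_toMatrix B,
    Matrix.det_of_injective_of_lt _ (position_injective G) htri, Finset.prod_congr rfl fun a _ => hdiag a,
    Fintype.prod_sum_type]
  simp only [jacobianDiag, Sum.elim_inl, Sum.elim_inr]
  rw [prod_edgeSet_inf, Finset.prod_mul_distrib, Finset.prod_const, Finset.card_univ, mul_assoc,
    ← Finset.prod_mul_distrib]
  simp_rw [pow_succ']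

end GWishart

/-! ### Normalizing constants as expectations -/

namespace GWishart

variable {V : Type*} [Fintype V] [LinearOrder V]

/-- The contribution to the normalizing constant of a vertex with `n` later neighbours. -/
noncomputable def vertexConst (δ : ℝ) (n : ℕ) : ℝ :=
  Real.Gamma ((δ + n) / 2) / (1 / 2) ^ ((δ + n) / 2) * √(2 * Real.pi) ^ n

theorem vertexConst_pos {δ : ℝ} (hδ : 0 < δ) (n : ℕ) : 0 < vertexConst δ n := by
  have : 0 < Real.Gamma ((δ + n) / 2) := Real.Gamma_pos_of_pos (by positivity)
  unfold vertexConst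
  positivity

theorem vertexConst_zero_div_one {δ : ℝ} (hδ : 0 < δ) :
    vertexConst δ 0 / vertexConst δ 1 =
      1 / (2 * √Real.pi) * (Real.Gamma (δ / 2) / Real.Gamma ((δ + 1) / 2)) := by
  have h1 : 0 < Real.Gamma ((δ + 1) / 2) := Real.Gamma_pos_of_pos (by positivity)
  have h2 : ((1 : ℝ) / 2) ^ ((δ + 1) / 2) = (1 / 2) ^ (δ / 2) * (√2)⁻¹ := by
    rw [add_div, Real.rpow_add (by norm_num), ← Real.sqrt_eq_rpow, one_div, Real.sqrt_inv]
  have h3 : √(2 * Real.pi) = √2 * √Real.pi := Real.sqrt_mul (by norm_num) _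
  have h4 : √(2 : ℝ) * √2 = 2 := Real.mul_self_sqrt (by norm_num)
  have h6 : 0 < √Real.pi := Real.sqrt_pos.2 Real.pi_pos
  have h7 : (0 : ℝ) < (1 / 2) ^ (δ / 2) := by positivity
  simp only [vertexConst, Nat.cast_zero, add_zero, Nat.cast_one, pow_zero, pow_one, mul_one, h2, h3]
  field_simp
  rw [sq, h4]

/-- The right side is grouped by origin: `2 t^(n+1)` is the share of the vertex in the Jacobian,
`t^(δ-2)` its share in the determinant power, and the exponential its share in the trace. -/
theorem chiPDF_mul_const {δ : ℝ} (hδ : 0 < δ) (n : ℕ) {t : ℝ} (ht : 0 < t) :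
    Real.Gamma ((δ + n) / 2) / (1 / 2) ^ ((δ + n) / 2) * chiPDF ((δ + n) / 2) t =
      2 * t ^ (n + 1) * t ^ (δ - 2) * Real.exp (-(1 / 2) * t ^ 2) := by
  have h1 : 0 < Real.Gamma ((δ + n) / 2) := Real.Gamma_pos_of_pos (by positivity)
  have h2 : (0 : ℝ) < (1 / 2) ^ ((δ + n) / 2) := by positivity
  have h3 : t ^ (2 * ((δ + n) / 2) - 1) = t ^ (n + 1) * t ^ (δ - 2) := by
    rw [← Real.rpow_natCast, ← Real.rpow_add ht]
    congr 1
    push_cast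
    ring
  rw [chiPDF, h3]
  field_simp

open Classical in
theorem freeDensity_mul_const (G : SimpleGraph V) {δ : ℝ} (hδ : 0 < δ)
    {x : (V → ℝ) × (G.edgeSet → ℝ)} (hx : x ∈ posDiag G) :
    (∏ i, vertexConst δ (nu G i)) * freeDensity G δ x =
      (2 ^ Fintype.card V * ∏ i, x.1 i ^ (nu G i + 1)) * (∏ i, x.1 i) ^ (δ - 2) *
        Real.exp (-(1 / 2) * (∑ i, x.1 i ^ 2 + ∑ a, x.2 a ^ 2)) := by
  have hg : ∀ t, √(2 * Real.pi) * gaussianPDFReal 0 1 t = Real.exp (-(1 / 2) * t ^ 2) := fun t => by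
    have : √(2 * Real.pi) ≠ 0 := (Real.sqrt_pos.2 (by positivity)).ne'
    simp only [gaussianPDFReal, NNReal.coe_one, mul_one, sub_zero]
    rw [mul_inv_cancel_left₀ this]
    congr 1
    ring
  have hv : ∏ i, vertexConst δ (nu G i) =
      (∏ i, Real.Gamma ((δ + nu G i) / 2) / (1 / 2) ^ ((δ + nu G i) / 2)) *
        ∏ _a : G.edgeSet, √(2 * Real.pi) := by
    rw [prod_edgeSet_inf G fun _ => √(2 * Real.pi), ← Finset.prod_mul_distrib]
    rfl
  rw [hv, freeDensity, mul_mul_mul_comm, ← Finset.prod_mul_distrib, ← Finset.prod_mul_distrib]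
  simp_rw [hg]
  rw [Finset.prod_congr rfl fun i _ => chiPDF_mul_const hδ (nu G i) (hx i),
    Finset.prod_mul_distrib, Finset.prod_mul_distrib, Finset.prod_mul_distrib,
    Finset.prod_const, Finset.card_univ, Real.finsetProd_rpow _ _ fun i _ => (hx i).le,
    mul_add, Real.exp_add, Finset.mul_sum, Finset.mul_sum, Real.exp_sum, Real.exp_sum]
  ring

/-- Change of variables along `cholMap`: Jacobian, determinant and the free part of the trace
recombine into the density of `freeLaw`, leaving only the non-free squares. -/
theorem normConst_eq (G : SimpleGraph V) {δ : ℝ} (hδ : 0 < δ) :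
    normConst G δ 1 = (∏ i, vertexConst δ (nu G i)) *
      ∫ x, Real.exp (-(1 / 2) * nonEdgeSqSum G (cholFill G x)) ∂(freeLaw G δ) := by
  classical
  have hS := measurableSet_posDiag G
  have : (volume : Measure ((V → ℝ) × (G.edgeSet → ℝ))).IsAddHaarMeasure :=
    Measure.prod.instIsAddHaarMeasure _ _
  rw [normConst, ← image_cholMap, integral_image_eq_integral_abs_det_fderiv_smul volume hS
    (fun x hx => (differentiableAt_cholMap G hx).hasFDerivAt.hasFDerivWithinAt) (injOn_cholMap G),
    freeLaw_eq_withDensity G hδ, integral_withDensity_eq_integral_toReal_smul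
      (measurable_freeDensity G δ).ennreal_ofReal (by simp), ← integral_const_mul]
  refine setIntegral_congr_fun hS fun x hx => ?_
  have hprod : 0 < ∏ i, x.1 i := Finset.prod_pos fun i _ => hx i
  have hdens : 0 ≤ freeDensity G δ x :=
    mul_nonneg (Finset.prod_nonneg fun i _ => chiPDF_nonneg (by positivity) (hx i))
      (Finset.prod_nonneg fun a _ => gaussianPDFReal_nonneg _ _ _)
  have hdet : 0 ≤ (2 : ℝ) ^ Fintype.card V * ∏ i, x.1 i ^ (nu G i + 1) :=
    mul_nonneg (by positivity) (Finset.prod_nonneg fun i _ => pow_nonneg (hx i).le _)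
  have hpow : ((∏ i, x.1 i) ^ 2) ^ ((δ - 2) / 2) = (∏ i, x.1 i) ^ (δ - 2) := by
    rw [← Real.rpow_natCast, ← Real.rpow_mul hprod.le]
    congr 1
    push_cast
    ring
  simp only [smul_eq_mul]
  rw [det_fderiv_cholMap G hx, abs_of_nonneg hdet, mul_one, det_symMatrix_cholMap G hx, hpow,
    trace_symMatrix_cholMap G hx, mul_add _ (_ + _), Real.exp_add, ENNReal.toReal_ofReal hdens,
    ← mul_assoc (∏ i, vertexConst δ (nu G i)), freeDensity_mul_const G hδ hx]
  ring

theorem measurable_nonEdgeSqSum (G H : SimpleGraph V) :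
    Measurable fun x => nonEdgeSqSum G (cholFill H x) := by
  have := measurable_cholFill H
  unfold nonEdgeSqSum
  fun_prop

theorem nonEdgeSqSum_nonneg (G : SimpleGraph V) (ψ : V → V → ℝ) : 0 ≤ nonEdgeSqSum G ψ :=
  Finset.sum_nonneg fun _ _ => sq_nonneg _

theorem expectation_pos (G : SimpleGraph V) {δ : ℝ} (hδ : 0 < δ) :
    0 < ∫ x, Real.exp (-(1 / 2) * nonEdgeSqSum G (cholFill G x)) ∂(freeLaw G δ) := by
  have := isProbabilityMeasure_freeLaw G hδ
  refine integral_exp_pos ?_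
  refine Integrable.of_bound (C := 1) ?_ (ae_of_all _ fun x => ?_)
  · exact ((measurable_nonEdgeSqSum G G).const_mul _).exp.aestronglyMeasurable
  · rw [Real.norm_of_nonneg (Real.exp_pos _).le, Real.exp_le_one_iff]
    nlinarith [nonEdgeSqSum_nonneg G (cholFill G x)]

/-- This also carries finiteness: the Bochner integral of a non-integrable function is 0 by
convention. -/
theorem normConst_pos (G : SimpleGraph V) {δ : ℝ} (hδ : 0 < δ) : 0 < normConst G δ 1 := by
  rw [normConst_eq G hδ]
  exact mul_pos (Finset.prod_pos fun i _ => vertexConst_pos hδ _) (expectation_pos G hδ)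

theorem ae_mem_posDiag (G : SimpleGraph V) {δ : ℝ} (hδ : 0 < δ) :
    ∀ᵐ x ∂(freeLaw G δ), x ∈ posDiag G := by
  rw [freeLaw_eq_withDensity G hδ]
  exact (withDensity_absolutelyContinuous _ _).ae_le (ae_restrict_mem (measurableSet_posDiag G))

/-! ### Effect of deleting the edge between the last two vertices -/

section DeleteEdge

variable {G : SimpleGraph V} {q p : V}

theorem nu_deleteEdges_of_ne (hlt : q < p) {i : V} (hi : i ≠ q) :
    nu (G.deleteEdges {s(q, p)}) i = nu G i := by
  classical
  unfold nu
  congr 1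
  ext j
  simp only [Finset.mem_filter, Finset.mem_univ, true_and, SimpleGraph.deleteEdges_adj,
    Set.mem_singleton_iff, Sym2.eq_iff]
  constructor
  · exact fun h => ⟨h.1, h.2.1⟩
  · rintro ⟨h1, h2⟩
    refine ⟨h1, h2, ?_⟩
    rintro (⟨rfl, rfl⟩ | ⟨rfl, rfl⟩)
    · exact hi rfl
    · exact h1.not_gt hlt

theorem nu_of_penultimate (hlt : q < p) (hlast : ∀ v, v ≤ q ∨ v = p) (hqp : G.Adj q p) :
    nu G q = 1 := by
  classical
  refine Finset.card_eq_one.2 ⟨p, ?_⟩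
  ext j
  simp only [Finset.mem_filter, Finset.mem_univ, true_and, Finset.mem_singleton]
  constructor
  · exact fun h => (hlast j).resolve_left h.1.not_ge
  · rintro rfl
    exact ⟨hlt, hqp⟩

theorem nu_deleteEdges_of_penultimate (hlast : ∀ v, v ≤ q ∨ v = p) :
    nu (G.deleteEdges {s(q, p)}) q = 0 := by
  simp only [nu, Finset.card_eq_zero, Finset.filter_eq_empty_iff]
  rintro j - ⟨h1, h2⟩
  rw [(hlast j).resolve_left h1.not_ge, SimpleGraph.deleteEdges_adj] at h2
  exact h2.2 rfl

/-- All factors cancel except the one at `q`, where the number of later neighbours falls from 1 to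
0. -/
theorem prod_vertexConst_ratio (hlt : q < p) (hlast : ∀ v, v ≤ q ∨ v = p) (hqp : G.Adj q p)
    {δ : ℝ} (hδ : 0 < δ) :
    (∏ i, vertexConst δ (nu (G.deleteEdges {s(q, p)}) i)) / ∏ i, vertexConst δ (nu G i) =
      1 / (2 * √Real.pi) * (Real.Gamma (δ / 2) / Real.Gamma ((δ + 1) / 2)) := by
  classical
  rw [← Finset.prod_div_distrib, Finset.prod_eq_single_of_mem q (Finset.mem_univ q),
    nu_of_penultimate hlt hlast hqp, nu_deleteEdges_of_penultimate hlast,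
    vertexConst_zero_div_one hδ]
  intro i _ hi
  rw [nu_deleteEdges_of_ne hlt hi, div_self (vertexConst_pos hδ _).ne']

theorem nonEdgeSqSum_deleteEdges (hlt : q < p) (hqp : G.Adj q p) (ψ : V → V → ℝ) :
    nonEdgeSqSum (G.deleteEdges {s(q, p)}) ψ = nonEdgeSqSum G ψ + ψ q p ^ 2 := by
  classical
  rw [nonEdgeSqSum, nonEdgeSqSum, add_comm, ← Finset.sum_insert (a := (q, p))
    (f := fun a => ψ a.1 a.2 ^ 2) (by simp [hqp])]
  refine Finset.sum_congr ?_ fun _ _ => rfl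
  ext ⟨i, j⟩
  simp only [Finset.mem_filter, Finset.mem_univ, true_and, Finset.mem_insert, Prod.mk.injEq,
    SimpleGraph.deleteEdges_adj, Set.mem_singleton_iff, Sym2.eq_iff, not_and, not_not]
  constructor
  · rintro ⟨h1, h2⟩
    by_cases hG : G.Adj i j
    · rcases h2 hG with h | ⟨rfl, rfl⟩
      · exact Or.inl h
      · exact absurd h1 hlt.not_gt
    · exact Or.inr ⟨h1, hG⟩
  · rintro (⟨rfl, rfl⟩ | ⟨h1, h2⟩)
    · exact ⟨hlt, fun _ => Or.inl ⟨rfl, rfl⟩⟩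
    · exact ⟨h1, fun h => absurd h h2⟩

end DeleteEdge

end GWishart

/-! ### Minimal paths in the adapted order -/

namespace GWishart

section Interior

variable {V : Type*} {H : SimpleGraph V} {q p : V}

theorem interiorVertices_eq (w : H.Walk q p) :
    interiorVertices w = (List.range (w.length - 1)).map fun n => w.getVert (n + 1) := by
  refine List.ext_getElem (by simp [interiorVertices]) fun n h1 h2 => ?_
  simp [interiorVertices, SimpleGraph.Walk.support_getElem_eq_getVert]

theorem length_interiorVertices (w : H.Walk q p) :
    (interiorVertices w).length = w.length - 1 := by
  simp [interiorVertices_eq]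

theorem mem_interiorVertices {w : H.Walk q p} {v : V} :
    v ∈ interiorVertices w ↔ ∃ n, 0 < n ∧ n < w.length ∧ w.getVert n = v := by
  rw [interiorVertices_eq, List.mem_map]
  constructor
  · rintro ⟨n, hn, rfl⟩
    rw [List.mem_range] at hn
    exact ⟨n + 1, by omega, by omega, rfl⟩
  · rintro ⟨n, h0, h1, rfl⟩
    refine ⟨n - 1, List.mem_range.2 (by omega), ?_⟩
    rw [Nat.sub_add_cancel h0]

theorem getVert_mem_interiorVertices {w : H.Walk q p} {n : ℕ} (h0 : 0 < n) (h1 : n < w.length) :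
    w.getVert n ∈ interiorVertices w :=
  mem_interiorVertices.2 ⟨n, h0, h1, rfl⟩

theorem mem_interiorVertices_of_mem_support {w : H.Walk q p} {v : V} (hv : v ∈ w.support)
    (hq : v ≠ q) (hp : v ≠ p) : v ∈ interiorVertices w := by
  obtain ⟨n, rfl, hn⟩ := SimpleGraph.Walk.mem_support_iff_exists_getVert.1 hv
  refine getVert_mem_interiorVertices (Nat.pos_of_ne_zero ?_) (lt_of_le_of_ne hn ?_)
  · rintro rfl
    exact hq w.getVert_zero
  · rintro rfl
    exact hp w.getVert_length

theorem prod_tail_interiorVertices (w : H.Walk q p) (f : V → ℝ) :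
    ((interiorVertices w).tail.map f).prod =
      ∏ n ∈ Finset.range (w.length - 2), f (w.getVert (n + 2)) := by
  have : (interiorVertices w).tail =
      (List.range (w.length - 2)).map fun n => w.getVert (n + 2) := by
    refine List.ext_getElem (by simp [interiorVertices_eq]; omega) fun n h1 h2 => ?_
    simp [interiorVertices_eq]
  rw [this, List.map_map]
  rfl

theorem prod_edges (w : H.Walk q p) (f : Sym2 V → ℝ) :
    (w.edges.map f).prod =
      ∏ n ∈ Finset.range w.length, f s(w.getVert n, w.getVert (n + 1)) := by
  have : w.edges = (List.range w.length).map fun n => s(w.getVert n, w.getVert (n + 1)) := by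
    refine List.ext_getElem (by simp) fun n h1 h2 => ?_
    simp [SimpleGraph.Walk.getElem_edges]
  rw [this, List.map_map]
  rfl

end Interior

variable {V : Type*} [LinearOrder V] {H : SimpleGraph V} {q p : V} {L : ℕ}
  {lam : Fin L → H.Walk q p}

namespace IsAdaptedOrder

theorem isPath (h : IsAdaptedOrder H q p lam) (k : Fin L) : (lam k).IsPath :=
  ((h.mem_iff (lam k)).1 ⟨k, rfl⟩).1

theorem start_lt_end (h : IsAdaptedOrder H q p lam) : q < p := by
  have := (List.pairwise_append.1 h.sorted).2.1
  simpa using this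

theorem lt_start (h : IsAdaptedOrder H q p lam) {k : Fin L} {v : V}
    (hv : v ∈ interiorVertices (lam k)) : v < q :=
  (List.pairwise_append.1 h.sorted).2.2 v
    (List.mem_flatten.2 ⟨_, List.mem_ofFn.2 ⟨k, rfl⟩, hv⟩) q (by simp)

theorem lt_of_lt (h : IsAdaptedOrder H q p lam) {k l : Fin L} (hkl : k < l) {u v : V}
    (hu : u ∈ interiorVertices (lam k)) (hv : v ∈ interiorVertices (lam l)) : u < v :=
  List.pairwise_ofFn.1 (List.pairwise_flatten.1 (List.pairwise_append.1 h.sorted).1).2 hkl u hu v hv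

/-- The concatenated list of interiors is strictly increasing, so no vertex occurs in two of them.
-/
theorem eq_of_mem (h : IsAdaptedOrder H q p lam) {k l : Fin L} {v : V}
    (hk : v ∈ interiorVertices (lam k)) (hl : v ∈ interiorVertices (lam l)) : k = l := by
  rcases lt_trichotomy k l with hkl | hkl | hkl
  · exact absurd (h.lt_of_lt hkl hk hl) (lt_irrefl v)
  · exact hkl
  · exact absurd (h.lt_of_lt hkl hl hk) (lt_irrefl v)

theorem getVert_lt_getVert (h : IsAdaptedOrder H q p lam) (k : Fin L) {m n : ℕ} (h0 : 0 < m)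
    (hmn : m < n) (hn : n < (lam k).length) : (lam k).getVert m < (lam k).getVert n := by
  have := (List.pairwise_flatten.1 (List.pairwise_append.1 h.sorted).1).1 _
    (List.mem_ofFn.2 ⟨k, rfl⟩)
  rw [interiorVertices_eq, List.pairwise_iff_getElem] at this
  have := this (m - 1) (n - 1) (by simp; omega) (by simp; omega) (by omega)
  simpa [Nat.sub_add_cancel h0, Nat.sub_add_cancel (h0.trans hmn)] using this

theorem getVert_lt_start (h : IsAdaptedOrder H q p lam) (k : Fin L) {n : ℕ} (h0 : 0 < n)
    (hn : n < (lam k).length) : (lam k).getVert n < q :=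
  h.lt_start (getVert_mem_interiorVertices h0 hn)

theorem mem_interior (h : IsAdaptedOrder H q p lam) (hunion : IsUnionOfMinimalPaths H q p)
    (v : V) : v = q ∨ v = p ∨ ∃ k, v ∈ interiorVertices (lam k) := by
  rcases hunion.vertices v with hv | hv | ⟨w, hw, hv⟩
  · exact Or.inl hv
  · exact Or.inr (Or.inl hv)
  · by_cases hq : v = q
    · exact Or.inl hq
    by_cases hp : v = p
    · exact Or.inr (Or.inl hp)
    obtain ⟨k, rfl⟩ := (h.mem_iff w).2 hw
    exact Or.inr (Or.inr ⟨k, mem_interiorVertices_of_mem_support hv hq hp⟩)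

theorem le_start_or_eq (h : IsAdaptedOrder H q p lam) (hunion : IsUnionOfMinimalPaths H q p)
    (v : V) : v ≤ q ∨ v = p := by
  rcases h.mem_interior hunion v with hv | hv | ⟨k, hv⟩
  · exact Or.inl hv.le
  · exact Or.inr hv
  · exact Or.inl (h.lt_start hv).le

theorem exists_getVert (h : IsAdaptedOrder H q p lam) (hunion : IsUnionOfMinimalPaths H q p)
    {v : V} (hv : v < q) : ∃ k n, 0 < n ∧ n < (lam k).length ∧ (lam k).getVert n = v := by
  rcases h.mem_interior hunion v with rfl | rfl | ⟨k, hk⟩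
  · exact absurd hv (lt_irrefl _)
  · exact absurd hv h.start_lt_end.not_gt
  · exact ⟨k, mem_interiorVertices.1 hk⟩

/-- The neighbours of an interior vertex are its neighbours along the path. -/
theorem adj_getVert (h : IsAdaptedOrder H q p lam) (hunion : IsUnionOfMinimalPaths H q p)
    {k : Fin L} {n : ℕ} (h0 : 0 < n) (hn : n < (lam k).length) {u : V}
    (hadj : H.Adj ((lam k).getVert n) u) :
    u = (lam k).getVert (n - 1) ∨ u = (lam k).getVert (n + 1) := by
  obtain ⟨w, hw, he⟩ := hunion.edges s((lam k).getVert n, u) hadj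
  obtain ⟨l, rfl⟩ := (h.mem_iff w).2 hw
  have hlt := h.getVert_lt_start k h0 hn
  have hmem := mem_interiorVertices_of_mem_support ((lam l).fst_mem_support_of_mem_edges he)
    hlt.ne (hlt.trans h.start_lt_end).ne
  obtain rfl := h.eq_of_mem (getVert_mem_interiorVertices h0 hn) hmem
  have := (h.isPath k).neighborSet_toSubgraph_internal h0.ne' hn
  have hu : u ∈ (lam k).toSubgraph.neighborSet ((lam k).getVert n) :=
    SimpleGraph.Walk.adj_toSubgraph_iff_mem_edges.2 he
  rwa [this] at hu

theorem getVert_injOn (h : IsAdaptedOrder H q p lam) (k : Fin L) {m n : ℕ}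
    (hm : m ≤ (lam k).length) (hn : n ≤ (lam k).length)
    (hmn : (lam k).getVert m = (lam k).getVert n) : m = n :=
  (h.isPath k).getVert_injOn hm hn hmn

theorem two_le_length (h : IsAdaptedOrder H q p lam) (hqp : ¬ H.Adj q p) (k : Fin L) :
    2 ≤ (lam k).length := by
  by_contra! hlt
  have h0 : (lam k).length ≠ 0 := fun h0 =>
    h.start_lt_end.ne (SimpleGraph.Walk.eq_of_length_eq_zero h0)
  have h1 : (lam k).length = 1 := by omega
  exact hqp (SimpleGraph.Walk.adj_of_length_eq_one h1)

/-- A lower neighbour of an interior vertex is the preceding vertex of its path. -/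
theorem adj_of_lt (h : IsAdaptedOrder H q p lam) (hunion : IsUnionOfMinimalPaths H q p)
    {k : Fin L} {n : ℕ} (h0 : 0 < n) (hn : n < (lam k).length) {r : V}
    (hadj : H.Adj r ((lam k).getVert n)) (hr : r < (lam k).getVert n) :
    2 ≤ n ∧ r = (lam k).getVert (n - 1) := by
  rcases h.adj_getVert hunion h0 hn hadj.symm with rfl | rfl
  · refine ⟨?_, rfl⟩
    -- For `n = 1` the preceding vertex is `q`, which lies above every interior vertex.
    by_contra! hlt
    obtain rfl : n = 1 := by omega
    rw [Nat.sub_self, SimpleGraph.Walk.getVert_zero] at hr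
    exact hr.not_gt (h.getVert_lt_start k h0 hn)
  · rcases lt_or_eq_of_le (Nat.succ_le_of_lt hn) with h1 | h1
    · exact absurd hr (h.getVert_lt_getVert k h0 (Nat.lt_succ_self n) h1).not_gt
    · rw [show n + 1 = (lam k).length from h1, SimpleGraph.Walk.getVert_length] at hr
      exact absurd hr ((h.getVert_lt_start k h0 hn).trans h.start_lt_end).not_gt

/-- An interior vertex has at most one interior neighbour above it. -/
theorem eq_of_adj_of_adj (h : IsAdaptedOrder H q p lam) (hunion : IsUnionOfMinimalPaths H q p)
    {r i j : V} (hri : r < i) (hi : i < q) (hi' : H.Adj r i) (hrj : r < j) (hj : j < q)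
    (hj' : H.Adj r j) : i = j := by
  obtain ⟨k, n, h0, hn, rfl⟩ := h.exists_getVert hunion (hri.trans hi)
  have key : ∀ u, (lam k).getVert n < u → u < q → H.Adj ((lam k).getVert n) u →
      u = (lam k).getVert (n + 1) := by
    intro u hnu hu hadj
    rcases h.adj_getVert hunion h0 hn hadj with rfl | rfl
    · rcases Nat.lt_or_ge 1 n with h1 | h1
      · exact absurd hnu (h.getVert_lt_getVert k (by omega) (by omega) hn).not_gt
      · obtain rfl : n = 1 := by omega
        simp at hu
    · rfl
  rw [key i hri hi hi', key j hrj hj hj']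

end IsAdaptedOrder

/-! ### Non-free entries of the Cholesky factor along the paths -/

variable [Fintype V] {ψ K : Matrix V V ℝ}

theorem IsCholeskyFactor.eq_neg_div (hψ : IsCholeskyFactor ψ K) (hK : K ∈ precisionCone H)
    {i j : V} (hij : i ≠ j) (hadj : ¬ H.Adj i j) :
    ψ i j = -(∑ r : {r : V // r < i}, ψ r i * ψ r j) / ψ i i := by
  have h0 : K i j = 0 := hK.2 i j hij hadj
  rw [hψ.eq, gram_apply hψ.upper] at h0
  rw [eq_div_iff (hψ.diag_pos i).ne']
  linarith

/-- Non-free entries between interior vertices vanish. -/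
theorem entry_eq_zero (h : IsAdaptedOrder H q p lam) (hunion : IsUnionOfMinimalPaths H q p)
    (hK : K ∈ precisionCone H) (hψ : IsCholeskyFactor ψ K) {i j : V} (hij : i < j) (hj : j < q)
    (hadj : ¬ H.Adj i j) : ψ i j = 0 := by
  induction i using WellFoundedLT.induction generalizing j with
  | ind i ih =>
    rw [hψ.eq_neg_div hK hij.ne hadj, Finset.sum_eq_zero, neg_zero, zero_div]
    rintro ⟨r, hr⟩ -
    -- A nonzero term would need `r` adjacent to both `i` and `j`, that is, two later interior
    -- neighbours; otherwise one factor is a non-free entry in the earlier row `r`.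
    by_cases h1 : H.Adj r i
    · by_cases h2 : H.Adj r j
      · exact absurd (h.eq_of_adj_of_adj hunion hr (hij.trans hj) h1 (hr.trans hij) hj h2) hij.ne
      · rw [ih r hr (hr.trans hij) hj h2, mul_zero]
    · rw [ih r hr hr (hij.trans hj) h1, zero_mul]

/-- The first interior vertex has no lower neighbour, because its path neighbours are `q` and a
later vertex. -/
theorem sum_lower_first (h : IsAdaptedOrder H q p lam) (hunion : IsUnionOfMinimalPaths H q p)
    (hK : K ∈ precisionCone H) (hψ : IsCholeskyFactor ψ K) {k : Fin L}
    (hk : 1 < (lam k).length) (j : V) :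
    ∑ r : {r : V // r < (lam k).getVert 1}, ψ r ((lam k).getVert 1) * ψ r j = 0 := by
  refine Finset.sum_eq_zero ?_
  rintro ⟨r, hr⟩ -
  rw [entry_eq_zero h hunion hK hψ hr (h.getVert_lt_start k one_pos hk) fun hadj =>
    absurd (h.adj_of_lt hunion one_pos hk hadj hr).1 (by norm_num), zero_mul]

/-- The only lower neighbour is the predecessor on the path, so elimination becomes a two-term
recursion along the path. -/
theorem sum_lower_succ (h : IsAdaptedOrder H q p lam) (hunion : IsUnionOfMinimalPaths H q p)
    (hK : K ∈ precisionCone H) (hψ : IsCholeskyFactor ψ K) {k : Fin L} {n : ℕ}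
    (hn : n + 2 < (lam k).length) (j : V) :
    ∑ r : {r : V // r < (lam k).getVert (n + 2)}, ψ r ((lam k).getVert (n + 2)) * ψ r j =
      ψ ((lam k).getVert (n + 1)) ((lam k).getVert (n + 2)) * ψ ((lam k).getVert (n + 1)) j := by
  have hlt := h.getVert_lt_getVert k (Nat.succ_pos n) (Nat.lt_succ_self (n + 1)) hn
  refine Fintype.sum_eq_single (⟨_, hlt⟩ : {r : V // r < (lam k).getVert (n + 2)}) ?_
  rintro ⟨r, hr⟩ hne
  rw [entry_eq_zero h hunion hK hψ hr (h.getVert_lt_start k (by omega) hn) fun hadj =>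
    hne (Subtype.ext (h.adj_of_lt hunion (by omega) hn hadj hr).2), zero_mul]

/-- The column of `p` vanishes at the interior vertices that are not adjacent to `p`. -/
theorem entry_end_eq_zero (h : IsAdaptedOrder H q p lam) (hunion : IsUnionOfMinimalPaths H q p)
    (hK : K ∈ precisionCone H) (hψ : IsCholeskyFactor ψ K) {k : Fin L} {n : ℕ}
    (hn : n + 2 < (lam k).length) : ψ ((lam k).getVert (n + 1)) p = 0 := by
  have hnadj : ∀ n, n + 2 < (lam k).length → ¬ H.Adj ((lam k).getVert (n + 1)) p := by
    intro n hn hadj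
    have hp := (lam k).getVert_length
    rcases h.adj_getVert hunion (Nat.succ_pos n) (by omega) hadj with h1 | h1
    · have := h.getVert_injOn k le_rfl (by omega) (hp.trans h1)
      omega
    · have := h.getVert_injOn k le_rfl (by omega) (hp.trans h1)
      omega
  have hne : ∀ n, n + 2 < (lam k).length → (lam k).getVert (n + 1) ≠ p := fun n hn =>
    ((h.getVert_lt_start k (Nat.succ_pos n) (by omega)).trans h.start_lt_end).ne
  induction n with
  | zero =>
    rw [hψ.eq_neg_div hK (hne 0 hn) (hnadj 0 hn), sum_lower_first h hunion hK hψ (by omega),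
      neg_zero, zero_div]
  | succ n ih =>
    rw [hψ.eq_neg_div hK (hne (n + 1) hn) (hnadj (n + 1) hn),
      sum_lower_succ h hunion hK hψ (by omega), ih (by omega), mul_zero, neg_zero, zero_div]

/-- The column of `q` along a path. -/
theorem entry_start_mul_prod (h : IsAdaptedOrder H q p lam) (hunion : IsUnionOfMinimalPaths H q p)
    (hK : K ∈ precisionCone H) (hψ : IsCholeskyFactor ψ K) {k : Fin L} {n : ℕ}
    (hn : n + 1 < (lam k).length) :
    ψ ((lam k).getVert (n + 1)) q *
        ∏ m ∈ Finset.range n, ψ ((lam k).getVert (m + 2)) ((lam k).getVert (m + 2)) =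
      (-1) ^ n * ψ ((lam k).getVert 1) q *
        ∏ m ∈ Finset.range n, ψ ((lam k).getVert (m + 1)) ((lam k).getVert (m + 2)) := by
  induction n with
  | zero => simp
  | succ n ih =>
    have hq := (lam k).getVert_zero
    have hnadj : ¬ H.Adj ((lam k).getVert (n + 2)) q := by
      intro hadj
      rcases h.adj_getVert hunion (Nat.succ_pos (n + 1)) (by omega) hadj with h1 | h1
      · have := h.getVert_injOn k (Nat.zero_le _) (by omega) (hq.trans h1)
        omega
      · have := h.getVert_injOn k (Nat.zero_le _) (by omega) (hq.trans h1)
        omega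
    have hne : (lam k).getVert (n + 2) ≠ q := (h.getVert_lt_start k (by omega) (by omega)).ne
    rw [Finset.prod_range_succ, Finset.prod_range_succ, hψ.eq_neg_div hK hne hnadj,
      sum_lower_succ h hunion hK hψ hn]
    have := (hψ.diag_pos ((lam k).getVert (n + 2))).ne'
    rw [mul_comm (∏ m ∈ Finset.range n, ψ ((lam k).getVert (m + 2)) _), ← mul_assoc,
      div_mul_cancel₀ _ this, neg_mul, mul_assoc (ψ ((lam k).getVert (n + 1)) _), ih (by omega)]
    ring

theorem pathSum_term (h : IsAdaptedOrder H q p lam) (hunion : IsUnionOfMinimalPaths H q p)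
    (hqp : ¬ H.Adj q p) (hK : K ∈ precisionCone H) (hψ : IsCholeskyFactor ψ K) (k : Fin L) :
    (-1) ^ (interiorVertices (lam k)).length *
        ((lam k).edges.map fun a => ψ a.inf a.sup).prod /
        (ψ q q * ((interiorVertices (lam k)).tail.map fun v => ψ v v).prod) =
      -(ψ ((lam k).getVert ((lam k).length - 1)) q * ψ ((lam k).getVert ((lam k).length - 1)) p) /
        ψ q q := by
  obtain ⟨n, hn⟩ := Nat.exists_eq_add_of_le (h.two_le_length hqp k)
  have hlen : (lam k).length = n + 2 := by omega
  have hend := hlen ▸ (lam k).getVert_length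
  have hfirst := h.getVert_lt_start k one_pos (by omega)
  have hlast := (h.getVert_lt_start k (n := n + 1) (Nat.succ_pos n) (by omega)).trans h.start_lt_end
  have hmid : ∀ m ∈ Finset.range n,
      ψ s((lam k).getVert (m + 1), (lam k).getVert (m + 2)).inf
          s((lam k).getVert (m + 1), (lam k).getVert (m + 2)).sup =
        ψ ((lam k).getVert (m + 1)) ((lam k).getVert (m + 2)) := fun m hm => by
    rw [Finset.mem_range] at hm
    have := (h.getVert_lt_getVert k (Nat.succ_pos m) (Nat.lt_succ_self (m + 1)) (by omega)).le
    simp [this]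
  rw [length_interiorVertices, prod_edges, prod_tail_interiorVertices, hlen,
    Finset.prod_range_succ, Finset.prod_range_succ', Finset.prod_congr rfl hmid, hend]
  simp only [SimpleGraph.Walk.getVert_zero, zero_add, Sym2.inf_mk, Sym2.sup_mk,
    inf_of_le_right hfirst.le, sup_of_le_left hfirst.le, inf_of_le_left hlast.le,
    sup_of_le_right hlast.le, Nat.add_sub_cancel, show n + 2 - 1 = n + 1 from rfl]
  have key := entry_start_mul_prod h hunion hK hψ (k := k) (n := n) (by omega)
  have hq := (hψ.diag_pos q).ne'
  have hP : ∏ m ∈ Finset.range n, ψ ((lam k).getVert (m + 2)) ((lam k).getVert (m + 2)) ≠ 0 :=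
    Finset.prod_ne_zero_iff.2 fun m _ => (hψ.diag_pos _).ne'
  rw [div_eq_div_iff (mul_ne_zero hq hP) hq, pow_succ]
  linear_combination ψ ((lam k).getVert (n + 1)) p * ψ q q * key

/-- The entry `ψ_qp` as a sum over the minimal paths between `q` and `p`. -/
theorem entry_eq_pathSum (h : IsAdaptedOrder H q p lam) (hunion : IsUnionOfMinimalPaths H q p)
    (hqp : ¬ H.Adj q p) (hK : K ∈ precisionCone H) (hψ : IsCholeskyFactor ψ K) :
    ψ q p = pathSum lam ψ := by
  unfold pathSum
  rw [Finset.sum_congr rfl fun k _ => pathSum_term h hunion hqp hK hψ k,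
    hψ.eq_neg_div hK h.start_lt_end.ne hqp, ← Finset.sum_div, Finset.sum_neg_distrib]
  congr 2
  have hlt : ∀ k, (lam k).getVert ((lam k).length - 1) < q := fun k => by
    have := h.two_le_length hqp k
    exact h.getVert_lt_start k (by omega) (by omega)
  refine (Fintype.sum_of_injective (fun k => (⟨_, hlt k⟩ : {r : V // r < q})) ?_ _ _ ?_ fun _ => rfl).symm
  · intro k l hkl
    have h1 := h.two_le_length hqp k
    have h2 := h.two_le_length hqp l
    have hk := getVert_mem_interiorVertices (w := lam k) (n := (lam k).length - 1) (by omega)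
      (by omega)
    rw [Subtype.mk.injEq] at hkl
    rw [hkl] at hk
    exact h.eq_of_mem hk (getVert_mem_interiorVertices (by omega) (by omega))
  · rintro ⟨r, hr⟩ hrange
    obtain ⟨k, n, h0, hn, rfl⟩ := h.exists_getVert hunion hr
    obtain ⟨m, rfl⟩ := Nat.exists_eq_add_of_le' h0
    have : m + 2 < (lam k).length := by
      refine lt_of_le_of_ne hn fun heq => hrange ⟨k, Subtype.ext ?_⟩
      change (lam k).getVert ((lam k).length - 1) = (lam k).getVert (m + 1)
      rw [← heq]
      rfl
    rw [entry_end_eq_zero h hunion hK hψ this, mul_zero]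

end GWishart

theorem proposition1 {V : Type*} [Fintype V] [LinearOrder V] (G : SimpleGraph V) (q p : V)
    (hqp : G.Adj q p) (δ : ℝ) (hδ : 2 < δ)
    (hunion : IsUnionOfMinimalPaths (G.deleteEdges {s(q, p)}) q p)
    (hdisj : ∀ w w' : (G.deleteEdges {s(q, p)}).Walk q p, IsMinimalPath w → IsMinimalPath w' →
      w ≠ w' → w.edges.Disjoint w'.edges)
    {L : ℕ} (lam : Fin L → (G.deleteEdges {s(q, p)}).Walk q p)
    (horder : IsAdaptedOrder (G.deleteEdges {s(q, p)}) q p lam) :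
    (0 < normConst G δ 1 ∧ 0 < normConst (G.deleteEdges {s(q, p)}) δ 1 ∧
      0 < ∫ x, Real.exp (-(1 / 2) * nonEdgeSqSum G (cholFill G x)) ∂(freeLaw G δ) ∧
      normConst (G.deleteEdges {s(q, p)}) δ 1 / normConst G δ 1 =
        1 / (2 * √Real.pi) * (Real.Gamma (δ / 2) / Real.Gamma ((δ + 1) / 2)) *
          ((∫ x, Real.exp (-(1 / 2) *
                (nonEdgeSqSum G (cholFill (G.deleteEdges {s(q, p)}) x) +
                  pathSum lam (cholFill (G.deleteEdges {s(q, p)}) x) ^ 2))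
              ∂(freeLaw (G.deleteEdges {s(q, p)}) δ)) /
            ∫ x, Real.exp (-(1 / 2) * nonEdgeSqSum G (cholFill G x)) ∂(freeLaw G δ))) ∧
    ∀ K ∈ precisionCone (G.deleteEdges {s(q, p)}), ∀ ψ : Matrix V V ℝ,
      IsCholeskyFactor ψ K → ψ q p = pathSum lam ψ := by
  have hδ0 : 0 < δ := two_pos.trans hδ
  have hlt := horder.start_lt_end
  have hnadj : ¬ (G.deleteEdges {s(q, p)}).Adj q p := by simp
  refine ⟨⟨normConst_pos G hδ0, normConst_pos _ hδ0, expectation_pos G hδ0, ?_⟩,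
    fun K hK ψ hψ => entry_eq_pathSum horder hunion hnadj hK hψ⟩
  rw [normConst_eq _ hδ0, normConst_eq G hδ0, mul_div_mul_comm,
    prod_vertexConst_ratio hlt (horder.le_start_or_eq hunion) hqp hδ0]
  congr 2
  refine integral_congr_ae ?_
  filter_upwards [ae_mem_posDiag (G.deleteEdges {s(q, p)}) hδ0] with x hx
  obtain ⟨K, hK, hψ⟩ := cholFill_isCholeskyFactor (G.deleteEdges {s(q, p)}) x hx
  have := entry_eq_pathSum horder hunion hnadj hK hψ
  rw [nonEdgeSqSum_deleteEdges hlt hqp]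
  congr 4
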